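/- Let $N\in\mathbb N$, let $\theta\neq 0$ be real, and let $S=\begin{pmatrix}0&1_N\\-1_N&0\end{pmatrix}$. For $f\in\mathcal S(\mathbb R^{2N})$ (complex-valued Schwartz functions) and $g\in L^2(\mathbb R^{2N})$, the Moyal product is $$(f\star_\theta g)(x)=(\pi\theta)^{-2N}\int\!\Bigl(\int f(y)\,e^{\frac{2i}{\theta}(x-y)\cdot S(x-z)}\,d^{2N}y\Bigr)g(z)\,d^{2N}z ,$$ and $g\mapsto f\star_\theta g$ is a bounded operator $L^\theta_f$ on $L^2(\mathbb R^{2N})$. Let $\mathcal H=L^2(\mathbb R^{2N})\otimes\mathbb C^{2^N}$ and let $\pi^\theta(f)=L^\theta_f\otimes 1$ act on $\mathcal H$ componentwise. Let $\gamma^1,\dots,\gamma^{2N}$ be Hermitian $2^N\times2^N$ matrices with $\gamma^\mu\gamma^\nu+\gamma^\nu\gamma^\mu=2\delta^{\mu\nu}$, and let $D=-i\sum_\mu\gamma^\mu\partial_\mu$ be the Euclidean Dirac operator, i.e. the unbounded operator on $\mathcal H$ with domain $\{\Psi\in\mathcal H: -i\sum_\mu\gamma^\mu\partial_\mu\Psi\in\mathcal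 H\}$, derivatives being taken in the sense of distributions. Theorem. For every $f\in\mathcal S(\mathbb R^{2N})$ and every $\lambda\in\mathbb C$ outside the spectrum of $D$, the operator $\pi^\theta(f)\,(D-\lambda)^{-1}$ is compact on $\mathcal H$. -/

import Mathlib

open MeasureTheory SchwartzMap
open scoped InnerProductSpace ENNReal LineDeriv FourierTransform

noncomputable section

namespace Moyal

/-! ### The phase space `ℝ²ᴺ` and the Moyal product -/

/-- Euclidean `ℝ²ᴺ`, with coordinates split into two blocks of length `N`. -/
abbrev Plane (N : ℕ) : Type := EuclideanSpace ℝ (Fin N ⊕ Fin N)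

/-- The standard symplectic matrix `S = (0, 1; -1, 0)`, acting on `ℝ²ᴺ`. -/
def symp (N : ℕ) : Plane N →L[ℝ] Plane N :=
  Matrix.toEuclideanCLM (n := Fin N ⊕ Fin N) (𝕜 := ℝ) (Matrix.fromBlocks 0 1 (-1) 0)

/-- The Moyal product with parameter `θ`,
`(f ⋆ g)(x) = (πθ)^{-2N} ∫∫ f(y) g(z) exp((2i/θ) (x - y) · S(x - z)) dy dz`.
The `y`-integration is carried out first: for a Schwartz function `f` and `θ ≠ 0` this gives an
absolutely convergent iterated integral for all square-integrable `g`, for vector-valued `g` too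
(and then the product is taken componentwise). -/
def moyalProd {N : ℕ} {F : Type*} [NormedAddCommGroup F] [NormedSpace ℂ F]
    (θ : ℝ) (f : 𝓢(Plane N, ℂ)) (g : Plane N → F) (x : Plane N) : F :=
  (((Real.pi * θ) ^ (2 * N) : ℝ) : ℂ)⁻¹ •
    ∫ z : Plane N,
      (∫ y : Plane N, f y * Complex.exp (Complex.I * ((2 / θ * ⟪x - y, symp N (x - z)⟫_ℝ : ℝ) : ℂ)))
        • g z

/-! ### Left Moyal multiplication is bounded on `L²` -/

theorem symp_symp {N : ℕ} (x : Plane N) : symp N (symp N x) = -x := by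
  ext i
  rcases i with i | i <;>
    simp [symp, Matrix.ofLp_toEuclideanCLM, Matrix.fromBlocks_mulVec, Matrix.neg_mulVec]

/-- `S / (πθ)` as an invertible linear map. -/
def sympEquiv (N : ℕ) (θ : ℝ) (hθ : θ ≠ 0) : Plane N ≃L[ℝ] Plane N :=
  ContinuousLinearEquiv.equivOfInverse ((Real.pi * θ)⁻¹ • symp N) (-(Real.pi * θ) • symp N)
    (fun x => by
      have : Real.pi * θ ≠ 0 := mul_ne_zero Real.pi_ne_zero hθ
      simp [symp_symp, smul_smul, -mul_inv_rev, this])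
    (fun x => by
      have : Real.pi * θ ≠ 0 := mul_ne_zero Real.pi_ne_zero hθ
      simp [symp_symp, smul_smul, -mul_inv_rev, this])

/-- The inner integral in the Moyal product. -/
def kernel {N : ℕ} (θ : ℝ) (f : 𝓢(Plane N, ℂ)) (x z : Plane N) : ℂ :=
  ∫ y : Plane N, f y * Complex.exp (Complex.I * ((2 / θ * ⟪x - y, symp N (x - z)⟫_ℝ : ℝ) : ℂ))

/-- The Schwartz function `𝓕 f ∘ S / (πθ)`. -/
def kernelAux {N : ℕ} (θ : ℝ) (hθ : θ ≠ 0) (f : 𝓢(Plane N, ℂ)) : 𝓢(Plane N, ℂ) :=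
  SchwartzMap.compCLMOfContinuousLinearEquiv ℂ (sympEquiv N θ hθ) (𝓕 f)

theorem kernel_eq {N : ℕ} (θ : ℝ) (hθ : θ ≠ 0) (f : 𝓢(Plane N, ℂ)) (x z : Plane N) :
    kernel θ f x z = Complex.exp (Complex.I * ((2 / θ * ⟪x, symp N (x - z)⟫_ℝ : ℝ) : ℂ)) *
      kernelAux θ hθ f (x - z) := by
  have hpi : Real.pi ≠ 0 := Real.pi_ne_zero
  simp only [kernelAux, SchwartzMap.compCLMOfContinuousLinearEquiv_apply, Function.comp_apply,
    SchwartzMap.fourier_coe, Real.fourier_eq', kernel]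
  rw [← integral_const_mul]
  congr 1
  ext y
  rw [smul_eq_mul, mul_comm (f y), ← mul_assoc, ← Complex.exp_add]
  congr 2
  have h : ⟪y, (sympEquiv N θ hθ) (x - z)⟫_ℝ = (Real.pi * θ)⁻¹ * ⟪y, symp N (x - z)⟫_ℝ := by
    change ⟪y, ((Real.pi * θ)⁻¹ • symp N) (x - z)⟫_ℝ = _
    rw [smul_apply, inner_smul_right]
  rw [h, inner_sub_left]
  have hpi' : (Real.pi : ℂ) ≠ 0 := by exact_mod_cast hpi
  have hθ' : (θ : ℂ) ≠ 0 := by exact_mod_cast hθ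
  push_cast
  field_simp
  ring

theorem norm_kernel {N : ℕ} (θ : ℝ) (hθ : θ ≠ 0) (f : 𝓢(Plane N, ℂ)) (x z : Plane N) :
    ‖kernel θ f x z‖ = ‖kernelAux θ hθ f (x - z)‖ := by
  rw [kernel_eq θ hθ, norm_mul, mul_comm Complex.I, Complex.norm_exp_ofReal_mul_I, one_mul]

theorem continuous_kernel {N : ℕ} (θ : ℝ) (hθ : θ ≠ 0) (f : 𝓢(Plane N, ℂ)) :
    Continuous (fun p : Plane N × Plane N => kernel θ f p.1 p.2) := by
  simp_rw [kernel_eq θ hθ]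
  have := (kernelAux θ hθ f).continuous
  fun_prop

theorem memLp_kernel {N : ℕ} (θ : ℝ) (hθ : θ ≠ 0) (f : 𝓢(Plane N, ℂ)) (x : Plane N) :
    MemLp (fun z => kernel θ f x z) 2 := by
  have h := ((kernelAux θ hθ f).memLp 2 volume).comp_measurePreserving
    (Measure.measurePreserving_sub_left volume x)
  refine h.congr_norm ?_ (Filter.Eventually.of_forall fun z => ?_)
  · have := continuous_kernel θ hθ f
    exact (Continuous.comp this (by fun_prop : Continuous fun z => (x, z))).aestronglyMeasurable
  · simp [norm_kernel θ hθ]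

section L2

variable {N : ℕ} {F : Type*} [NormedAddCommGroup F] [NormedSpace ℂ F]

theorem moyalProd_eq (θ : ℝ) (f : 𝓢(Plane N, ℂ)) (g : Plane N → F) (x : Plane N) :
    moyalProd θ f g x =
      (((Real.pi * θ) ^ (2 * N) : ℝ) : ℂ)⁻¹ • ∫ z : Plane N, kernel θ f x z • g z := rfl

theorem integrable_kernel_smul (θ : ℝ) (hθ : θ ≠ 0) (f : 𝓢(Plane N, ℂ)) {g : Plane N → F}
    (hg : MemLp g 2) (x : Plane N) : Integrable (fun z => kernel θ f x z • g z) :=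
  memLp_one_iff_integrable.1 (hg.smul (memLp_kernel θ hθ f x))

theorem moyalProd_congr (θ : ℝ) (f : 𝓢(Plane N, ℂ)) {g h : Plane N → F}
    (hgh : g =ᵐ[volume] h) : moyalProd θ f g = moyalProd θ f h := by
  ext x
  rw [moyalProd_eq, moyalProd_eq]
  congr 1
  refine integral_congr_ae ?_
  filter_upwards [hgh] with z hz
  rw [hz]

theorem moyalProd_add (θ : ℝ) (hθ : θ ≠ 0) (f : 𝓢(Plane N, ℂ)) {g h : Plane N → F}
    (hg : MemLp g 2) (hh : MemLp h 2) :
    moyalProd θ f (g + h) = moyalProd θ f g + moyalProd θ f h := by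
  ext x
  simp only [Pi.add_apply, moyalProd_eq, smul_add]
  rw [integral_add (integrable_kernel_smul θ hθ f hg x) (integrable_kernel_smul θ hθ f hh x),
    smul_add]

theorem moyalProd_smul (θ : ℝ) (f : 𝓢(Plane N, ℂ)) (c : ℂ) (g : Plane N → F) :
    moyalProd θ f (c • g) = c • moyalProd θ f g := by
  ext x
  simp only [Pi.smul_apply, moyalProd_eq]
  simp_rw [smul_comm _ c (_ : F)]
  rw [integral_smul, smul_comm]

/-- The Cauchy–Schwarz step of Schur's test. -/
theorem lintegral_mul_sq_le {G φ : Plane N → ℝ≥0∞} (hG : AEMeasurable G) (hφ : AEMeasurable φ) :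
    (∫⁻ z, G z * φ z) ^ (2 : ℝ) ≤ (∫⁻ z, G z) * ∫⁻ z, G z * φ z ^ (2 : ℝ) := by
  have h := ENNReal.lintegral_mul_le_Lp_mul_Lq (volume : Measure (Plane N))
    Real.HolderConjugate.two_two (hG.pow_const (1 / 2 : ℝ))
    ((hG.pow_const (1 / 2 : ℝ)).mul hφ)
  have e1 : ∀ z, ((fun z => G z ^ (1 / 2 : ℝ)) * ((fun z => G z ^ (1 / 2 : ℝ)) * φ)) z
      = G z * φ z := by
    intro z
    simp only [Pi.mul_apply]
    rw [← mul_assoc, ← ENNReal.rpow_add_of_nonneg _ _ (by norm_num) (by norm_num)]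
    norm_num
  have e2 : ∀ z, (G z ^ (1 / 2 : ℝ)) ^ (2 : ℝ) = G z := by
    intro z
    rw [← ENNReal.rpow_mul]
    norm_num
  have e3 : ∀ z, (((fun z => G z ^ (1 / 2 : ℝ)) * φ) z) ^ (2 : ℝ) = G z * φ z ^ (2 : ℝ) := by
    intro z
    simp only [Pi.mul_apply]
    rw [ENNReal.mul_rpow_of_nonneg _ _ (by norm_num), e2]
  simp_rw [e1, e2, e3] at h
  refine (ENNReal.rpow_le_rpow h (by norm_num : (0 : ℝ) ≤ 2)).trans ?_
  rw [ENNReal.mul_rpow_of_nonneg _ _ (by norm_num), ← ENNReal.rpow_mul, ← ENNReal.rpow_mul]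
  norm_num

theorem eLpNorm_moyalProd_le (θ : ℝ) (hθ : θ ≠ 0) (f : 𝓢(Plane N, ℂ)) {g : Plane N → F}
    (hg : MemLp g 2) :
    eLpNorm (moyalProd θ f g) 2 volume ≤
      ‖(((Real.pi * θ) ^ (2 * N) : ℝ) : ℂ)⁻¹‖ₑ * (∫⁻ z, ‖kernelAux θ hθ f z‖ₑ)
        * eLpNorm g 2 volume := by
  set c : ℂ := (((Real.pi * θ) ^ (2 * N) : ℝ) : ℂ)⁻¹
  set k := kernelAux θ hθ f
  have hkm : Measurable (fun z => ‖k z‖ₑ) := k.continuous.enorm.measurable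
  have hgm : AEMeasurable (fun z => ‖g z‖ₑ) := hg.1.enorm
  have hpt : ∀ x, ‖moyalProd θ f g x‖ₑ ^ (2 : ℝ) ≤
      ‖c‖ₑ ^ (2 : ℝ) * ((∫⁻ z, ‖k z‖ₑ) * ∫⁻ z, ‖k (x - z)‖ₑ * ‖g z‖ₑ ^ (2 : ℝ)) := by
    intro x
    rw [moyalProd_eq, enorm_smul, ENNReal.mul_rpow_of_nonneg _ _ (by norm_num)]
    gcongr
    have h1 : ‖∫ z, kernel θ f x z • g z‖ₑ ≤ ∫⁻ z, ‖k (x - z)‖ₑ * ‖g z‖ₑ := by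
      refine (enorm_integral_le_lintegral_enorm _).trans (lintegral_mono fun z => ?_)
      rw [enorm_smul]
      gcongr
      rw [← ofReal_norm, ← ofReal_norm, norm_kernel θ hθ]
    refine (ENNReal.rpow_le_rpow h1 (by norm_num)).trans ?_
    refine (lintegral_mul_sq_le (hkm.comp (by fun_prop)).aemeasurable hgm).trans ?_
    exact mul_le_mul_left (lintegral_sub_left_eq_self (μ := volume) (fun z => ‖k z‖ₑ) x).le _
  have hI : ∫⁻ x, ‖moyalProd θ f g x‖ₑ ^ (2 : ℝ) ≤
      (‖c‖ₑ * ∫⁻ z, ‖k z‖ₑ) ^ (2 : ℝ) * ∫⁻ z, ‖g z‖ₑ ^ (2 : ℝ) := by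
    refine (lintegral_mono hpt).trans ?_
    have hm : AEMeasurable (fun p : Plane N × Plane N => ‖k (p.1 - p.2)‖ₑ * ‖g p.2‖ₑ ^ (2 : ℝ))
        (volume.prod volume) := by
      refine AEMeasurable.mul (hkm.comp (by fun_prop)).aemeasurable ?_
      exact (hgm.pow_const _).comp_snd
    have hkfin : ∫⁻ z, ‖k z‖ₑ ≠ ∞ := k.integrable.2.ne
    rw [lintegral_const_mul' _ _ (by simp),
      lintegral_const_mul' _ _ hkfin, lintegral_lintegral_swap hm]
    have h2 : ∀ z, ∫⁻ x, ‖k (x - z)‖ₑ * ‖g z‖ₑ ^ (2 : ℝ) =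
        (∫⁻ x, ‖k x‖ₑ) * ‖g z‖ₑ ^ (2 : ℝ) := by
      intro z
      have hkz : Measurable (fun x => ‖k (x - z)‖ₑ) := hkm.comp (measurable_sub_const z)
      rw [lintegral_mul_const _ hkz, lintegral_sub_right_eq_self (fun x => ‖k x‖ₑ) z]
    simp_rw [h2]
    rw [lintegral_const_mul' _ _ hkfin, ENNReal.mul_rpow_of_nonneg _ _ (by norm_num)]
    refine le_of_eq ?_
    rw [show (∫⁻ z, ‖k z‖ₑ) ^ (2 : ℝ) = (∫⁻ z, ‖k z‖ₑ) * ∫⁻ z, ‖k z‖ₑ by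
      rw [ENNReal.rpow_two, sq]]
    ring
  rw [eLpNorm_eq_lintegral_rpow_enorm_toReal (by norm_num) (by norm_num),
    eLpNorm_eq_lintegral_rpow_enorm_toReal (by norm_num) (by norm_num)]
  simp only [ENNReal.toReal_ofNat]
  refine (ENNReal.rpow_le_rpow hI (by norm_num)).trans ?_
  rw [ENNReal.mul_rpow_of_nonneg _ _ (by norm_num), ← ENNReal.rpow_mul]
  norm_num

theorem memLp_moyalProd (θ : ℝ) (hθ : θ ≠ 0) (f : 𝓢(Plane N, ℂ)) {g : Plane N → F}
    (hg : MemLp g 2) : MemLp (moyalProd θ f g) 2 := by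
  refine ⟨?_, (eLpNorm_moyalProd_le θ hθ f hg).trans_lt ?_⟩
  · have h : AEStronglyMeasurable (fun p : Plane N × Plane N => kernel θ f p.1 p.2 • g p.2)
        (volume.prod volume) :=
      (continuous_kernel θ hθ f).aestronglyMeasurable.smul hg.1.comp_snd
    exact h.integral_prod_right'.const_smul _
  · exact ENNReal.mul_lt_top (ENNReal.mul_lt_top (by simp) (kernelAux θ hθ f).integrable.2) hg.2

/-- Left Moyal multiplication `g ↦ f ⋆ g` by a Schwartz function `f`, as a bounded operator
on `L²(ℝ²ᴺ; F)`. -/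
def leftMoyal (θ : ℝ) (hθ : θ ≠ 0) (f : 𝓢(Plane N, ℂ)) :
    Lp F 2 (volume : Measure (Plane N)) →L[ℂ] Lp F 2 (volume : Measure (Plane N)) :=
  LinearMap.mkContinuousOfExistsBound
    { toFun := fun g => (memLp_moyalProd θ hθ f (Lp.memLp g)).toLp (moyalProd θ f g)
      map_add' := fun g h => by
        rw [← MemLp.toLp_add, MemLp.toLp_eq_toLp_iff,
          moyalProd_congr θ f (Lp.coeFn_add g h),
          moyalProd_add θ hθ f (Lp.memLp g) (Lp.memLp h)]
      map_smul' := fun c g => by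
        rw [RingHom.id_apply, ← MemLp.toLp_const_smul, MemLp.toLp_eq_toLp_iff,
          moyalProd_congr θ f (Lp.coeFn_smul c g), moyalProd_smul] }
    ⟨(‖(((Real.pi * θ) ^ (2 * N) : ℝ) : ℂ)⁻¹‖ₑ * (∫⁻ z, ‖kernelAux θ hθ f z‖ₑ)).toReal,
      fun g => by
        have h := eLpNorm_moyalProd_le θ hθ f (Lp.memLp g)
        change ‖(memLp_moyalProd θ hθ f (Lp.memLp g)).toLp (moyalProd θ f g)‖ ≤ _
        rw [Lp.norm_toLp, Lp.norm_def, ← ENNReal.toReal_mul]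
        refine ENNReal.toReal_mono (ENNReal.mul_lt_top (ENNReal.mul_lt_top (by simp)
          (kernelAux θ hθ f).integrable.2) (Lp.memLp g).2).ne h⟩

theorem coeFn_leftMoyal (θ : ℝ) (hθ : θ ≠ 0) (f : 𝓢(Plane N, ℂ))
    (g : Lp F 2 (volume : Measure (Plane N))) :
    leftMoyal θ hθ f g =ᵐ[volume] moyalProd θ f g :=
  (memLp_moyalProd θ hθ f (Lp.memLp g)).coeFn_toLp

end L2

/-! ### Spinors and the Dirac operator -/

/-- The fibre `ℂ^{2^N}` of the spinor bundle. -/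
abbrev Fibre (N : ℕ) : Type := EuclideanSpace ℂ (Fin (2 ^ N))

/-- The Hilbert space `L²(ℝ²ᴺ) ⊗ ℂ^{2^N} = L²(ℝ²ᴺ; ℂ^{2^N})` of square-integrable spinors. -/
abbrev Spinors (N : ℕ) : Type := Lp (Fibre N) 2 (volume : Measure (Plane N))

/-- The Moyal product of a scalar function with a spinor is taken component by component. -/
theorem moyalProd_component {N : ℕ} (θ : ℝ) (hθ : θ ≠ 0) (f : 𝓢(Plane N, ℂ))
    {Ψ : Plane N → Fibre N} (hΨ : MemLp Ψ 2) (x : Plane N) (i : Fin (2 ^ N)) :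
    moyalProd θ f Ψ x i = moyalProd θ f (fun z => Ψ z i) x := by
  rw [moyalProd_eq, moyalProd_eq]
  have h := (EuclideanSpace.proj i : Fibre N →L[ℂ] ℂ).integral_comp_comm
    (integrable_kernel_smul θ hθ f hΨ x)
  simp only [EuclideanSpace.coe_proj, PiLp.smul_apply] at h ⊢
  rw [h]

/-- The representation `f ↦ L_f ⊗ 1` of the Schwartz functions on the space of spinors by left
Moyal multiplication. -/
def rep {N : ℕ} (θ : ℝ) (hθ : θ ≠ 0) (f : 𝓢(Plane N, ℂ)) : Spinors N →L[ℂ] Spinors N :=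
  leftMoyal θ hθ f

/-- Hermitian Dirac matrices: `2N` Hermitian matrices of size `2^N` with
`γ^μ γ^ν + γ^ν γ^μ = 2 δ^{μν}`. (They generate a representation of the Clifford algebra of `ℝ²ᴺ`
on `ℂ^{2^N}`, which is irreducible because of its dimension.) -/
structure IsDiracMatrices {N : ℕ}
    (γ : Fin N ⊕ Fin N → Matrix (Fin (2 ^ N)) (Fin (2 ^ N)) ℂ) : Prop where
  isHermitian : ∀ μ, (γ μ).IsHermitian
  anticomm : ∀ μ ν, γ μ * γ ν + γ ν * γ μ = if μ = ν then 2 else 0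

/-- The differential operator `-i ∑_μ γ^μ ∂_μ` on spinor-valued tempered distributions. -/
def diracDistr {N : ℕ} (γ : Fin N ⊕ Fin N → Matrix (Fin (2 ^ N)) (Fin (2 ^ N)) ℂ) :
    𝓢'(Plane N, Fibre N) →ₗ[ℂ] 𝓢'(Plane N, Fibre N) :=
  (-Complex.I) • ∑ μ,
    (PointwiseConvergenceCLM.postcomp 𝓢(Plane N, ℂ)
        (Matrix.toEuclideanCLM (n := Fin (2 ^ N)) (𝕜 := ℂ) (γ μ))).toLinearMap ∘ₗ
      (LineDeriv.lineDerivOpCLM ℂ 𝓢'(Plane N, Fibre N)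
        (EuclideanSpace.single μ (1 : ℝ) : Plane N)).toLinearMap

/-- The inclusion of `L²` spinors into tempered distributions. -/
def toDistr (N : ℕ) : Spinors N →ₗ[ℂ] 𝓢'(Plane N, Fibre N) :=
  (Lp.toTemperedDistributionCLM (Fibre N) (volume : Measure (Plane N)) 2).toLinearMap

theorem toDistr_injective (N : ℕ) : Function.Injective (toDistr N) :=
  LinearMap.ker_eq_bot.1 (Lp.ker_toTemperedDistributionCLM_eq_bot (F := Fibre N)
    (μ := (volume : Measure (Plane N))) (p := 2))

/-- The Dirac operator `-i γ^μ ∂_μ` as an unbounded operator on `L²` spinors. Derivatives are taken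
in the sense of distributions, and the domain consists of all `L²` spinors `Ψ` such that
`-i γ^μ ∂_μ Ψ` is an `L²` spinor. -/
def dirac {N : ℕ} (γ : Fin N ⊕ Fin N → Matrix (Fin (2 ^ N)) (Fin (2 ^ N)) ℂ) :
    Spinors N →ₗ.[ℂ] Spinors N where
  domain := (toDistr N).range.comap (diracDistr γ ∘ₗ toDistr N)
  toFun := (LinearEquiv.ofInjective (toDistr N) (toDistr_injective N)).symm.toLinearMap ∘ₗ
    (diracDistr γ ∘ₗ toDistr N).restrict (fun _ h => h)

theorem toDistr_dirac {N : ℕ} (γ : Fin N ⊕ Fin N → Matrix (Fin (2 ^ N)) (Fin (2 ^ N)) ℂ)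
    (Ψ : (dirac γ).domain) : toDistr N (dirac γ Ψ) = diracDistr γ (toDistr N Ψ) := by
  have h := (LinearEquiv.ofInjective (toDistr N) (toDistr_injective N)).apply_symm_apply
    ((diracDistr γ ∘ₗ toDistr N).restrict
      (p := (dirac γ).domain) (q := (toDistr N).range) (fun _ h => h) Ψ)
  exact congrArg Subtype.val h

/-! ### Spectrum and resolvent of an unbounded operator -/

section Resolvent

variable {H : Type*} [NormedAddCommGroup H] [NormedSpace ℂ H]

/-- `R` is a bounded two-sided inverse of `D - z`. -/
def IsResolventAt (D : H →ₗ.[ℂ] H) (z : ℂ) (R : H →L[ℂ] H) : Prop :=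
  (∀ x : H, ∃ h : R x ∈ D.domain, D ⟨R x, h⟩ - z • R x = x) ∧
    ∀ x : D.domain, R (D x - z • (x : H)) = x

/-- The spectrum of an unbounded operator `D`: all `z` for which `D - z` does not have a bounded
everywhere defined inverse. -/
def spec (D : H →ₗ.[ℂ] H) : Set ℂ := {z | ¬ ∃ R : H →L[ℂ] H, IsResolventAt D z R}

open Classical in
/-- The resolvent operator `(D - z)⁻¹` for `z` outside the spectrum (and `0` on the spectrum). -/
def resolventOp (D : H →ₗ.[ℂ] H) (z : ℂ) : H →L[ℂ] H :=
  if h : ∃ R : H →L[ℂ] H, IsResolventAt D z R then h.choose else 0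

theorem isResolventAt_resolventOp {D : H →ₗ.[ℂ] H} {z : ℂ} (hz : z ∉ spec D) :
    IsResolventAt D z (resolventOp D z) := by
  have h : ∃ R : H →L[ℂ] H, IsResolventAt D z R := not_not.1 hz
  rw [resolventOp, dif_pos h]
  exact h.choose_spec

theorem IsResolventAt.unique {D : H →ₗ.[ℂ] H} {z : ℂ} {R R' : H →L[ℂ] H}
    (hR : IsResolventAt D z R) (hR' : IsResolventAt D z R') : R = R' := by
  ext x
  obtain ⟨h, hx⟩ := hR'.1 x
  have := hR.2 ⟨R' x, h⟩
  rwa [hx] at this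

end Resolvent

end Moyal

end

/-! Everything is done in momentum space. By the Clifford relations the symbol of `D` squares to
`|ξ|²`, so the Fourier transform of `DΨ` has pointwise norm `2π|ξ|` times that of `Ψ`
(`fourier_dirac`). Discarding the frequencies `|ξ| > r` therefore costs at most `r⁻¹‖DΨ‖` in `L²`
(`norm_sub_cutoff_fourier_le`). For `R = (D - λ)⁻¹` the operator `DR = 1 + λR` is bounded, so
`π(f)R` is the operator-norm limit of the same operators with a momentum cutoff inserted, and it
suffices that these are compact.

With the cutoff to a set `s` of finite volume, `f ⋆ ·` becomes an integral operator from momentum to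
position space. The Moyal kernel is a Fourier transform (`exists_kernel_eq_fourier`), so the new
kernel is, up to a constant, a phase times `f(x + L⁻¹ξ)`, with `L = S/(πθ)`. Its square integral
over `x` and `ξ ∈ s` is, up to a constant, `‖f‖² · vol(s)`. The operator is thus Hilbert–Schmidt,
hence compact (`isCompactOperator_of_ae_eq_apply`). -/

noncomputable section

namespace Moyal


/-! ### Hilbert–Schmidt operators are compact -/

section HilbertSchmidt

variable {H K : Type*} [NormedAddCommGroup H] [InnerProductSpace ℂ H]
  [NormedAddCommGroup K] [InnerProductSpace ℂ K] [CompleteSpace K]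

/-- A bounded operator whose values on a Hilbert basis are square summable is compact. -/
theorem isCompactOperator_of_summable_norm_sq {ι : Type*} (b : HilbertBasis ι ℂ H)
    (T : H →L[ℂ] K) (h : Summable fun i => ‖T (b i)‖ ^ 2) : IsCompactOperator T := by
  classical
  -- Finite-rank truncations: `T` after the projection onto the span of the `b i` with `i ∈ s`.
  let A : Finset ι → H →L[ℂ] K := fun s => ∑ i ∈ s, (innerSL ℂ (b i)).smulRight (T (b i))
  have hA : ∀ s x, A s x = ∑ i ∈ s, ⟪b i, x⟫_ℂ • T (b i) := fun s x => by
    simp [A, sum_apply]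
  have hcomp : ∀ s, IsCompactOperator (A s) := fun s => by
    refine (compactOperator (RingHom.id ℂ) H K).sum_mem fun i _ => ?_
    exact (isCompactOperator_of_locallyCompactSpace_rng
      (ContinuousLinearMap.toSpanSingleton ℂ (T (b i)))).comp_clm (innerSL ℂ (b i))
  refine isCompactOperator_of_tendsto (l := Filter.atTop) (F := A) ?_
    (Filter.Eventually.of_forall hcomp)
  rw [Metric.tendsto_nhds]
  intro ε hε
  obtain ⟨s₀, hs₀⟩ := summable_iff_vanishing_norm.1 h ((ε / 2) ^ 2) (by positivity)
  filter_upwards [Filter.eventually_ge_atTop s₀] with s hs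
  rw [dist_comm, dist_eq_norm]
  refine lt_of_le_of_lt (ContinuousLinearMap.opNorm_le_bound _ (half_pos hε).le fun x => ?_)
    (half_lt_self hε)
  -- Passing to the limit in `t ⊇ s` reduces the tail to finite sums, where Cauchy–Schwarz and
  -- Bessel apply.
  have hlim : Filter.Tendsto (fun t => A t x - A s x) Filter.atTop (nhds (T x - A s x)) := by
    refine Filter.Tendsto.sub_const ?_ _
    have := (b.hasSum_repr x).mapL T
    simp only [map_smul, b.repr_apply_apply] at this
    simpa only [hA, HasSum, SummationFilter.unconditional_filter] using this
  refine le_of_tendsto hlim.norm ?_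
  filter_upwards [Filter.eventually_ge_atTop s] with t ht
  have hsub : A t x - A s x = ∑ i ∈ t \ s, ⟪b i, x⟫_ℂ • T (b i) := by
    rw [hA, hA, sub_eq_iff_eq_add, Finset.sum_sdiff ht]
  have h1 : ∑ i ∈ t \ s, ‖T (b i)‖ ^ 2 ≤ (ε / 2) ^ 2 := by
    have := hs₀ (t \ s) (Finset.disjoint_of_subset_right hs Finset.sdiff_disjoint)
    exact (le_abs_self _).trans this.le
  have h2 := b.orthonormal.sum_inner_products_le (x := x) (s := t \ s)
  rw [hsub]
  calc ‖∑ i ∈ t \ s, ⟪b i, x⟫_ℂ • T (b i)‖ ≤ ∑ i ∈ t \ s, ‖⟪b i, x⟫_ℂ‖ * ‖T (b i)‖ :=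
        (norm_sum_le _ _).trans (Finset.sum_le_sum fun i _ => norm_smul_le _ _)
    _ ≤ √(∑ i ∈ t \ s, ‖⟪b i, x⟫_ℂ‖ ^ 2) * √(∑ i ∈ t \ s, ‖T (b i)‖ ^ 2) :=
        Real.sum_mul_le_sqrt_mul_sqrt _ _ _
    _ ≤ √(‖x‖ ^ 2) * √((ε / 2) ^ 2) := by gcongr
    _ = ε / 2 * ‖x‖ := by
        rw [Real.sqrt_sq (norm_nonneg _), Real.sqrt_sq (half_pos hε).le, mul_comm]

/-- Expand `T (v i)` in an orthonormal basis `o` of `F` and move `T` to the other side: for each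
`k`, Bessel bounds the sum over `i` by `‖T* (o k)‖² ≤ ‖T‖²`. -/
theorem sum_norm_sq_apply_le {ι : Type*} {F : Type*} [NormedAddCommGroup F] [InnerProductSpace ℂ F]
    [FiniteDimensional ℂ F] [CompleteSpace H] {v : ι → H} (hv : Orthonormal ℂ v) (s : Finset ι)
    (T : H →L[ℂ] F) : ∑ i ∈ s, ‖T (v i)‖ ^ 2 ≤ Module.finrank ℂ F * ‖T‖ ^ 2 := by
  have := FiniteDimensional.complete ℂ F
  let o := stdOrthonormalBasis ℂ F
  have h1 : ∀ i, ‖T (v i)‖ ^ 2 = ∑ k, ‖⟪v i, T.adjoint (o k)⟫_ℂ‖ ^ 2 := fun i => by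
    rw [← o.sum_sq_norm_inner_right]
    refine Finset.sum_congr rfl fun k _ => ?_
    rw [ContinuousLinearMap.adjoint_inner_right, norm_inner_symm]
  simp_rw [h1]
  rw [Finset.sum_comm]
  calc _ ≤ ∑ k : Fin (Module.finrank ℂ F), ‖T‖ ^ 2 := by
        refine Finset.sum_le_sum fun k _ => (hv.sum_inner_products_le _).trans ?_
        gcongr
        refine (T.adjoint.le_opNorm _).trans ?_
        simp [o.orthonormal.1 k]
    _ = _ := by simp

/-- An operator into a vector-valued `L²` space is compact if it is given by square-integrable
functionals. -/
theorem isCompactOperator_of_ae_eq_apply [CompleteSpace H] {X F : Type*} [MeasurableSpace X]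
    {μ : Measure X} [NormedAddCommGroup F] [InnerProductSpace ℂ F] [FiniteDimensional ℂ F]
    [CompleteSpace F]
    (T : H →L[ℂ] Lp F 2 μ) (ℓ : X → H →L[ℂ] F) (hT : ∀ g, T g =ᵐ[μ] fun x => ℓ x g)
    (hℓ : ∫⁻ x, ‖ℓ x‖ₑ ^ 2 ∂μ ≠ ∞) : IsCompactOperator T := by
  obtain ⟨w, b, -⟩ := exists_hilbertBasis ℂ H
  refine isCompactOperator_of_summable_norm_sq b T ?_
  set d := Module.finrank ℂ F
  refine summable_of_sum_le (c := (d * ∫⁻ x, ‖ℓ x‖ₑ ^ 2 ∂μ).toReal) (fun _ => by positivity)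
    fun s => ?_
  have h1 : ∀ i, ENNReal.ofReal (‖T (b i)‖ ^ 2) = ∫⁻ x, ‖T (b i) x‖ₑ ^ 2 ∂μ := fun i => by
    rw [ENNReal.ofReal_pow (norm_nonneg _), ofReal_norm, Lp.enorm_def,
      eLpNorm_eq_lintegral_rpow_enorm_toReal (by norm_num) (by norm_num), ← ENNReal.rpow_natCast,
      ← ENNReal.rpow_mul]
    norm_num
  rw [← ENNReal.ofReal_le_iff_le_toReal (ENNReal.mul_ne_top (by simp) hℓ),
    ENNReal.ofReal_sum_of_nonneg (fun _ _ => by positivity)]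
  simp_rw [h1]
  rw [← lintegral_finsetSum' _ fun i _ => (Lp.aestronglyMeasurable _).enorm.pow_const _,
    ← lintegral_const_mul' _ _ (by simp)]
  refine lintegral_mono_ae ?_
  -- Only finitely many exceptional null sets are united, so no countability of the basis is needed.
  have h2 : ∀ᵐ x ∂μ, ∀ i ∈ s, T (b i) x = ℓ x (b i) :=
    (s.eventually_all).2 fun i _ => hT (b i)
  filter_upwards [h2] with x hx
  have h3 := sum_norm_sq_apply_le b.orthonormal s (ℓ x)
  have h4 := ENNReal.ofReal_le_ofReal h3
  rw [ENNReal.ofReal_sum_of_nonneg (fun _ _ => by positivity), ENNReal.ofReal_mul (by positivity),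
    ENNReal.ofReal_natCast, ENNReal.ofReal_pow (norm_nonneg _), ofReal_norm] at h4
  refine le_trans (le_of_eq (Finset.sum_congr rfl fun i hi => ?_)) h4
  rw [hx i hi, ENNReal.ofReal_pow (norm_nonneg _), ofReal_norm]

end HilbertSchmidt


/-! ### Cutoffs -/

section Cutoff

variable {X E : Type*} [MeasurableSpace X] {μ : Measure X} [NormedAddCommGroup E] [NormedSpace ℂ E]

/-- Multiplication by the indicator function of a measurable set, as an operator on `L²`. -/
def cutoff {s : Set X} (hs : MeasurableSet s) : Lp E 2 μ →L[ℂ] Lp E 2 μ :=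
  LinearMap.mkContinuous
    { toFun := fun g => ((Lp.memLp g).indicator hs).toLp (s.indicator g)
      map_add' := fun g h => by
        rw [← MemLp.toLp_add, MemLp.toLp_eq_toLp_iff, ← Set.indicator_add']
        filter_upwards [Lp.coeFn_add g h] with x hx
        simp only [Set.indicator, hx]
      map_smul' := fun c g => by
        rw [RingHom.id_apply, ← MemLp.toLp_const_smul, MemLp.toLp_eq_toLp_iff]
        filter_upwards [Lp.coeFn_smul c g] with x hx
        by_cases hxs : x ∈ s <;> simp [hxs, hx] }
    1 fun g => by
      change ‖((Lp.memLp g).indicator hs).toLp (s.indicator g)‖ ≤ _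
      rw [one_mul, Lp.norm_toLp, Lp.norm_def]
      exact ENNReal.toReal_mono (Lp.memLp g).2.ne (eLpNorm_indicator_le _)

theorem coeFn_cutoff {s : Set X} (hs : MeasurableSet s) (g : Lp E 2 μ) :
    cutoff hs g =ᵐ[μ] s.indicator g :=
  ((Lp.memLp g).indicator hs).coeFn_toLp

end Cutoff

/-! ### Fibrewise linear maps: measurability and integrals -/

theorem aestronglyMeasurable_apply {X F : Type*} [TopologicalSpace X]
    [TopologicalSpace.PseudoMetrizableSpace X] [SecondCountableTopology X] [MeasurableSpace X]
    [OpensMeasurableSpace X] {μ : Measure X} [NormedAddCommGroup F] [NormedSpace ℂ F]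
    {A : X → F →L[ℂ] F} (hA : Continuous A) {φ : X → F} (hφ : AEStronglyMeasurable φ μ) :
    AEStronglyMeasurable (fun x => A x (φ x)) μ :=
  (show Continuous fun p : X × F => A p.1 p.2 by fun_prop).comp_aestronglyMeasurable
    (continuous_id.aestronglyMeasurable.prodMk hφ)

theorem sum_smul_apply_integral {X F : Type*} [MeasurableSpace X] {μ : Measure X}
    [NormedAddCommGroup F] [NormedSpace ℂ F] [CompleteSpace F] {ι : Type*} [Fintype ι] (c : ℂ)
    (Γ : ι → F →L[ℂ] F) (φ : ι → X → F) (hφ : ∀ i, Integrable (φ i) μ) :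
    ∑ i, c • Γ i (∫ x, φ i x ∂μ) = ∫ x, ∑ i, c • Γ i (φ i x) ∂μ := by
  rw [integral_finsetSum (f := fun i x => c • Γ i (φ i x)) _
    fun i _ => ((Γ i).integrable_comp (hφ i)).smul c]
  refine Finset.sum_congr rfl fun i _ => ?_
  rw [← (Γ i).integral_comp_comm (hφ i), ← integral_smul]

/-! ### The Dirac operator in momentum space -/

section Dirac

variable {N : ℕ} {γ : Fin N ⊕ Fin N → Matrix (Fin (2 ^ N)) (Fin (2 ^ N)) ℂ}

/-- The symbol `∑_μ ξ_μ γ^μ` of the Dirac operator. -/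
def symbol (γ : Fin N ⊕ Fin N → Matrix (Fin (2 ^ N)) (Fin (2 ^ N)) ℂ) (ξ : Plane N) :
    Fibre N →L[ℂ] Fibre N :=
  ∑ μ, (ξ μ : ℂ) • Matrix.toEuclideanCLM (n := Fin (2 ^ N)) (𝕜 := ℂ) (γ μ)

theorem symbol_eq (ξ : Plane N) : symbol γ ξ =
    Matrix.toEuclideanCLM (n := Fin (2 ^ N)) (𝕜 := ℂ) (∑ μ, (ξ μ : ℂ) • γ μ) := by
  simp only [symbol, map_sum, map_smul]

theorem continuous_symbol : Continuous (symbol γ) := by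
  unfold symbol
  fun_prop

/-- Adding the double sum to its copy with indices exchanged produces anticommutators, of which only
the diagonal survives. -/
theorem IsDiracMatrices.sum_mul_sum (hγ : IsDiracMatrices γ) (ξ : Plane N) :
    (∑ μ, (ξ μ : ℂ) • γ μ) * (∑ μ, (ξ μ : ℂ) • γ μ) = ((‖ξ‖ ^ 2 : ℝ) : ℂ) • 1 := by
  set P := ∑ μ, (ξ μ : ℂ) • γ μ
  have h1 : P * P = ∑ μ, ∑ ν, ((ξ μ : ℂ) * ξ ν) • (γ μ * γ ν) := by
    rw [Finset.sum_mul_sum]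
    simp only [smul_mul_smul_comm]
  have h2 : P * P = ∑ μ, ∑ ν, ((ξ μ : ℂ) * ξ ν) • (γ ν * γ μ) := by
    rw [h1, Finset.sum_comm]
    exact Finset.sum_congr rfl fun μ _ => Finset.sum_congr rfl fun ν _ => by rw [mul_comm (ξ ν : ℂ)]
  have h3 : P * P + P * P = (2 : ℂ) • (((‖ξ‖ ^ 2 : ℝ) : ℂ) • 1) := by
    nth_rewrite 1 [h1]
    rw [h2, ← Finset.sum_add_distrib]
    simp_rw [← Finset.sum_add_distrib, ← smul_add, hγ.anticomm]
    simp only [smul_ite, smul_zero, Finset.sum_ite_eq, Finset.mem_univ, if_true]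
    rw [← Finset.sum_smul, EuclideanSpace.real_norm_sq_eq, smul_smul, mul_comm, ← smul_smul,
      ofNat_smul_eq_nsmul]
    simp [pow_two]
  rw [← two_smul ℂ] at h3
  exact smul_right_injective _ two_ne_zero h3

/-- The symbol is self-adjoint with square `‖ξ‖²`, so `‖σv‖² = ⟪v, σ²v⟫ = ‖ξ‖²‖v‖²`. -/
theorem IsDiracMatrices.norm_symbol (hγ : IsDiracMatrices γ) (ξ : Plane N) (v : Fibre N) :
    ‖symbol γ ξ v‖ = ‖ξ‖ * ‖v‖ := by
  have hsa : IsSelfAdjoint (symbol γ ξ) := by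
    have h : IsSelfAdjoint (∑ μ, (ξ μ : ℂ) • γ μ) :=
      isSelfAdjoint_sum _ fun μ _ => IsSelfAdjoint.smul (Complex.conj_ofReal _)
        (hγ.isHermitian μ)
    rw [symbol_eq]
    exact h.map _
  have hsq : symbol γ ξ (symbol γ ξ v) = ((‖ξ‖ ^ 2 : ℝ) : ℂ) • v := by
    rw [symbol_eq, ← mul_apply_eq_comp, ← map_mul, hγ.sum_mul_sum, map_smul, map_one]
    rfl
  have h : ‖symbol γ ξ v‖ ^ 2 = (‖ξ‖ * ‖v‖) ^ 2 := by
    have e : ∀ w : Fibre N, ((‖w‖ ^ 2 : ℝ) : ℂ) = ⟪w, w⟫_ℂ := fun w => by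
      rw [inner_self_eq_norm_sq_to_K, Complex.ofReal_pow]
      rfl
    rw [← Complex.ofReal_inj, e, ← ContinuousLinearMap.adjoint_inner_right, ← ContinuousLinearMap.star_eq_adjoint,
      hsa.star_eq, hsq, inner_smul_right, ← e]
    push_cast
    ring
  exact (pow_left_inj₀ (by positivity) (by positivity) two_ne_zero).1 h

/-- The Fourier transform turns `∂_μ` into multiplication by `2πi ξ_μ`, here carried by the test
function; the prefactor `-i` leaves `2π`. -/
theorem fourier_diracDistr_apply (T : 𝓢'(Plane N, Fibre N)) (u : 𝓢(Plane N, ℂ)) :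
    𝓕 (diracDistr γ T) u = ∑ μ, (2 * Real.pi : ℂ) •
      Matrix.toEuclideanCLM (n := Fin (2 ^ N)) (𝕜 := ℂ) (γ μ)
        (𝓕 T (SchwartzMap.smulLeftCLM ℂ
          (fun x : Plane N => ((inner ℝ x (EuclideanSpace.single μ (1 : ℝ)) : ℝ) : ℂ)) u)) := by
  have h : ∀ μ : Fin N ⊕ Fin N,
      (∂_{(EuclideanSpace.single μ (1 : ℝ) : Plane N)} T) (𝓕 u) =
      (2 * Real.pi * Complex.I : ℂ) • 𝓕 T (SchwartzMap.smulLeftCLM ℂ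
          (fun x : Plane N => ((inner ℝ x (EuclideanSpace.single μ (1 : ℝ)) : ℝ) : ℂ)) u) := by
    intro μ
    rw [← TemperedDistribution.fourier_apply, TemperedDistribution.fourier_lineDerivOp_eq]
    rfl
  rw [TemperedDistribution.fourier_apply]
  have h' : diracDistr γ T (𝓕 u) =
      (-Complex.I) • ∑ μ, Matrix.toEuclideanCLM (n := Fin (2 ^ N)) (𝕜 := ℂ) (γ μ)
        ((∂_{(EuclideanSpace.single μ (1 : ℝ) : Plane N)} T) (𝓕 u)) := by
    simp only [diracDistr, LinearMap.smul_apply, LinearMap.sum_apply, LinearMap.comp_apply,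
      smul_apply, sum_apply]
    rfl
  rw [h', Finset.smul_sum]
  refine Finset.sum_congr rfl fun μ _ => ?_
  rw [h, map_smul, smul_smul]
  congr 1
  rw [mul_comm (2 * _ : ℂ), ← mul_assoc, neg_mul, Complex.I_mul_I, neg_neg, one_mul]

theorem integral_smul_symbol {φ : Plane N → Fibre N} (hφ : MemLp φ 2) (u : 𝓢(Plane N, ℂ)) :
    ∑ μ, (2 * Real.pi : ℂ) • Matrix.toEuclideanCLM (n := Fin (2 ^ N)) (𝕜 := ℂ) (γ μ)
      (∫ ξ, SchwartzMap.smulLeftCLM ℂ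
        (fun x : Plane N => ((inner ℝ x (EuclideanSpace.single μ (1 : ℝ)) : ℝ) : ℂ)) u ξ • φ ξ) =
    ∫ ξ, u ξ • ((2 * Real.pi : ℂ) • symbol γ ξ (φ ξ)) := by
  have hint : ∀ w : 𝓢(Plane N, ℂ), Integrable fun ξ => w ξ • φ ξ := fun w =>
    memLp_one_iff_integrable.1 (hφ.smul (w.memLp 2 volume))
  rw [sum_smul_apply_integral _ _ _ fun μ => hint _]
  refine integral_congr_ae (.of_forall fun ξ => ?_)
  simp only [symbol]
  rw [sum_apply, Finset.smul_sum, Finset.smul_sum]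
  refine Finset.sum_congr rfl fun μ _ => ?_
  rw [SchwartzMap.smulLeftCLM_apply_apply (by fun_prop), map_smul, smul_apply,
    EuclideanSpace.inner_single_right, one_mul, smul_smul, smul_smul, smul_smul]
  congr 1
  simp only [smul_eq_mul, conj_trivial]
  ring

/-- Supplies the regularity needed to identify functions from their integrals against test
functions; the pointwise norm is `2π‖ξ‖‖φ ξ‖`. -/
theorem locallyIntegrable_symbol (hγ : IsDiracMatrices γ) {φ : Plane N → Fibre N}
    (hφ : MemLp φ 2) :
    LocallyIntegrable (fun ξ => (2 * Real.pi : ℂ) • symbol γ ξ (φ ξ)) volume := by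
  have h : LocallyIntegrable (fun ξ => ‖ξ‖ • φ ξ) volume :=
    (hφ.locallyIntegrable (by norm_num)).continuous_smul continuous_norm
  have h2 : LocallyIntegrable (fun ξ => symbol γ ξ (φ ξ)) volume := by
    refine h.mono (aestronglyMeasurable_apply continuous_symbol hφ.1) (.of_forall fun ξ => ?_)
    rw [hγ.norm_symbol, norm_smul, norm_norm]
  exact h2.smul (2 * Real.pi : ℂ)

/-- Both sides define the same tempered distribution, and locally integrable functions with equal
integrals against test functions agree almost everywhere. -/
theorem fourier_dirac (hγ : IsDiracMatrices γ) (Ψ : (dirac γ).domain) :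
    (𝓕 (dirac γ Ψ) : Spinors N) =ᵐ[volume]
      fun ξ => (2 * Real.pi : ℂ) • symbol γ ξ ((𝓕 (Ψ : Spinors N) : Spinors N) ξ) := by
  set φ : Spinors N := 𝓕 (Ψ : Spinors N)
  have hkey : ∀ u : 𝓢(Plane N, ℂ), ∫ ξ, u ξ • (𝓕 (dirac γ Ψ) : Spinors N) ξ =
      ∫ ξ, u ξ • ((2 * Real.pi : ℂ) • symbol γ ξ (φ ξ)) := by
    intro u
    have h1 : ((dirac γ Ψ : Spinors N) : 𝓢'(Plane N, Fibre N)) =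
      diracDistr γ ((Ψ : Spinors N) : 𝓢'(Plane N, Fibre N)) := toDistr_dirac γ Ψ
    rw [← Lp.toTemperedDistribution_apply, ← Lp.fourier_toTemperedDistribution_eq, h1,
      fourier_diracDistr_apply, Lp.fourier_toTemperedDistribution_eq,
      ← integral_smul_symbol (Lp.memLp φ)]
    simp_rw [Lp.toTemperedDistribution_apply]
    rfl
  refine ae_eq_of_integral_contDiff_smul_eq ((Lp.memLp _).locallyIntegrable (by norm_num))
    (locallyIntegrable_symbol hγ (Lp.memLp φ)) fun g g_smooth g_cpt => ?_
  -- The test functions are real-valued, so they are cast to `ℂ` to become Schwartz functions as in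
  -- `hkey`.
  have hg₁ : HasCompactSupport (Complex.ofRealCLM ∘ g) := g_cpt.comp_left rfl
  have hg₂ : ContDiff ℝ (⊤ : ℕ∞) (Complex.ofRealCLM ∘ g) := by fun_prop
  simpa using hkey (hg₁.toSchwartzMap hg₂)

/-- Inside the ball the difference vanishes; outside, `r ≤ 2π‖ξ‖`, and the factor `2π ≥ 1` is given
away. -/
theorem norm_sub_cutoff_fourier_le (hγ : IsDiracMatrices γ) (Ψ : (dirac γ).domain) {r : ℝ}
    (hr : 0 < r) :
    ‖(𝓕 (Ψ : Spinors N) : Spinors N) -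
        cutoff (Metric.isClosed_closedBall (x := (0 : Plane N)) (ε := r)).measurableSet
          (𝓕 (Ψ : Spinors N))‖ ≤ r⁻¹ * ‖dirac γ Ψ‖ := by
  rw [← Lp.norm_fourier_eq (dirac γ Ψ)]
  refine Lp.norm_le_mul_norm_of_ae_le_mul ?_
  set φ : Spinors N := 𝓕 (Ψ : Spinors N)
  filter_upwards [Lp.coeFn_sub φ (cutoff (Metric.isClosed_closedBall (x := (0 : Plane N))
    (ε := r)).measurableSet φ), coeFn_cutoff (Metric.isClosed_closedBall (x := (0 : Plane N))
    (ε := r)).measurableSet φ, fourier_dirac hγ Ψ] with ξ h1 h2 h3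
  rw [h1, Pi.sub_apply, h2, h3, norm_smul, hγ.norm_symbol]
  by_cases hξ : ξ ∈ Metric.closedBall (0 : Plane N) r
  · rw [Set.indicator_of_mem hξ, sub_self, norm_zero]
    positivity
  · rw [Set.indicator_of_notMem hξ, sub_zero]
    have h4 : r < ‖ξ‖ := by simpa using hξ
    have h5 : ‖(2 * Real.pi : ℂ)‖ = 2 * Real.pi := by
      simp [Real.pi_pos.le]
    have h6 : 1 ≤ 2 * Real.pi := by linarith [Real.pi_gt_three]
    rw [h5, inv_mul_eq_div, le_div_iff₀ hr]
    have h7 : r ≤ 2 * Real.pi * ‖ξ‖ := by nlinarith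
    nlinarith [norm_nonneg (φ ξ)]

end Dirac


/-! ### The Moyal product in momentum space -/

section Kernel

variable {N : ℕ}

/-- The `n`-th derivative is `iⁿ` times the function and has modulus one, so exponent `0` and
constant `1` serve for every `n`. -/
theorem hasTemperateGrowth_exp_ofReal_mul_I :
    (fun t : ℝ => Complex.exp (t * Complex.I)).HasTemperateGrowth := by
  have hd : ∀ t : ℝ, HasDerivAt (fun t : ℝ => Complex.exp (t * Complex.I))
      (Complex.exp (t * Complex.I) * Complex.I) t := fun t => by
    simpa using ((Complex.ofRealCLM.hasDerivAt (x := t)).mul_const Complex.I).cexp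
  have hderiv : ∀ n : ℕ, iteratedDeriv n (fun t : ℝ => Complex.exp (t * Complex.I)) =
      fun t : ℝ => Complex.I ^ n * Complex.exp (t * Complex.I) := fun n => by
    induction n with
    | zero => simp
    | succ n ih =>
      rw [iteratedDeriv_succ, ih]
      ext t
      rw [((hd t).const_mul _).deriv]
      ring
  refine ⟨(Complex.ofRealCLM.contDiff.mul contDiff_const).cexp, fun n => ⟨0, 1, fun t => ?_⟩⟩
  rw [norm_iteratedFDeriv_eq_norm_iteratedDeriv, hderiv]
  simp [Complex.norm_exp_ofReal_mul_I]

theorem hasTemperateGrowth_phase (x : Plane N) :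
    (fun ξ : Plane N => Complex.exp ((2 * Real.pi * ⟪ξ, x⟫_ℝ : ℝ) * Complex.I)).HasTemperateGrowth :=
  hasTemperateGrowth_exp_ofReal_mul_I.comp
    (f := fun ξ : Plane N => 2 * Real.pi * ⟪ξ, x⟫_ℝ) (by fun_prop)

/-- The function `ξ ↦ exp (2πi ξ · x) f(x + L⁻¹ ξ)` with `L = S / (πθ)`. -/
def momentumKernel (θ : ℝ) (hθ : θ ≠ 0) (f : 𝓢(Plane N, ℂ)) (x : Plane N) : 𝓢(Plane N, ℂ) :=
  SchwartzMap.smulLeftCLM ℂ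
    (fun ξ : Plane N => Complex.exp ((2 * Real.pi * ⟪ξ, x⟫_ℝ : ℝ) * Complex.I))
    (SchwartzMap.compCLMOfContinuousLinearEquiv ℂ (sympEquiv N θ hθ).symm
      (SchwartzMap.compSubConstCLM ℂ (-x) f))

theorem momentumKernel_apply (θ : ℝ) (hθ : θ ≠ 0) (f : 𝓢(Plane N, ℂ)) (x ξ : Plane N) :
    momentumKernel θ hθ f x ξ = Complex.exp ((2 * Real.pi * ⟪ξ, x⟫_ℝ : ℝ) * Complex.I) *
      f ((sympEquiv N θ hθ).symm ξ + x) := by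
  rw [momentumKernel, SchwartzMap.smulLeftCLM_apply_apply (hasTemperateGrowth_phase x)]
  simp

theorem norm_momentumKernel_apply (θ : ℝ) (hθ : θ ≠ 0) (f : 𝓢(Plane N, ℂ)) (x ξ : Plane N) :
    ‖momentumKernel θ hθ f x ξ‖ = ‖f ((sympEquiv N θ hθ).symm ξ + x)‖ := by
  rw [momentumKernel_apply, norm_mul, Complex.norm_exp_ofReal_mul_I, one_mul]

theorem inner_symp_symp (x y : Plane N) : ⟪symp N x, symp N y⟫_ℝ = ⟪x, y⟫_ℝ := by
  simp [symp, PiLp.inner_apply, Matrix.ofLp_toEuclideanCLM, Matrix.fromBlocks_mulVec,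
    Matrix.neg_mulVec, add_comm]

/-- A linear change of variables. -/
theorem exists_integral_comp_eq (L : Plane N ≃L[ℝ] Plane N) :
    ∃ C : ℝ, ∀ g : Plane N → ℂ, ∫ y, g y = C • ∫ ξ, g (L ξ) := by
  -- Uniqueness of Haar measure gives the constant; its value is irrelevant for compactness, so no
  -- determinant is computed.
  have h : Measure.IsAddHaarMeasure (Measure.map L (volume : Measure (Plane N))) :=
    L.isAddHaarMeasure_map volume
  refine ⟨(Measure.addHaarScalarFactor volume (Measure.map L (volume : Measure (Plane N)))),
    fun g => ?_⟩
  have h2 := Measure.isAddLeftInvariant_eq_smul (volume : Measure (Plane N))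
    (Measure.map L (volume : Measure (Plane N)))
  have h3 := L.toHomeomorph.measurableEmbedding.integral_map (μ := volume) g
  nth_rewrite 1 [h2]
  rw [integral_smul_nnreal_measure]
  change _ • ∫ y, g y ∂(Measure.map L volume) = _
  exact congrArg _ h3

/-- The Moyal kernel is a Fourier transform. -/
theorem exists_kernel_eq_fourier (θ : ℝ) (hθ : θ ≠ 0) :
    ∃ C : ℝ, ∀ (f : 𝓢(Plane N, ℂ)) (x z : Plane N),
      kernel θ f x z = C • (𝓕 (momentumKernel θ hθ f x)) z := by
  obtain ⟨C, hC⟩ := exists_integral_comp_eq (sympEquiv N θ hθ).symm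
  refine ⟨C, fun f x z => ?_⟩
  -- Substitute `y = L⁻¹ξ + x`.
  rw [kernel, ← integral_add_right_eq_self _ x, hC, SchwartzMap.fourier_coe, Real.fourier_eq']
  congr 2
  ext ξ
  rw [momentumKernel_apply, smul_eq_mul, ← mul_assoc, ← Complex.exp_add, mul_comm]
  congr 2
  -- Since `S` is orthogonal, the Moyal phase becomes `2π⟪ξ, x - z⟫`: the Fourier character in `z`
  -- times the phase in `momentumKernel`.
  have h1 : x - ((sympEquiv N θ hθ).symm ξ + x) = (Real.pi * θ) • symp N ξ := by
    change x - ((-(Real.pi * θ) • symp N) ξ + x) = _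
    rw [smul_apply, neg_smul]
    abel
  have hθ' : (θ : ℂ) ≠ 0 := by exact_mod_cast hθ
  rw [h1, real_inner_smul_left, inner_symp_symp, inner_sub_right]
  push_cast
  field_simp
  ring

theorem exists_moyalProd_eq (θ : ℝ) (hθ : θ ≠ 0) :
    ∃ c : ℂ, ∀ (f : 𝓢(Plane N, ℂ)) (G : Spinors N) (x : Plane N),
      moyalProd θ f G x = c • ∫ ξ, momentumKernel θ hθ f x ξ • (𝓕 G : Spinors N) ξ := by
  obtain ⟨C, hC⟩ := exists_kernel_eq_fourier (N := N) θ hθ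
  refine ⟨(((Real.pi * θ) ^ (2 * N) : ℝ) : ℂ)⁻¹ * C, fun f G x => ?_⟩
  -- The Fourier transform passes from the kernel to `G` through the duality defining it on tempered
  -- distributions.
  rw [moyalProd_eq, ← Lp.toTemperedDistribution_apply, ← Lp.fourier_toTemperedDistribution_eq,
    TemperedDistribution.fourier_apply, Lp.toTemperedDistribution_apply, mul_smul]
  congr 1
  rw [← integral_smul]
  congr 1
  ext1 z
  rw [hC, ← Complex.coe_smul, smul_assoc]

/-- The square of the Hilbert–Schmidt norm of `f ⋆ ·` after a momentum cutoff is finite. -/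
theorem lintegral_momentumKernel_ne_top (θ : ℝ) (hθ : θ ≠ 0) (f : 𝓢(Plane N, ℂ))
    {s : Set (Plane N)} (hs' : volume s ≠ ∞) :
    ∫⁻ x, ∫⁻ ξ in s, ‖momentumKernel θ hθ f x ξ‖ₑ ^ 2 ≠ ∞ := by
  have h1 : ∀ x ξ, ‖momentumKernel θ hθ f x ξ‖ₑ = ‖f ((sympEquiv N θ hθ).symm ξ + x)‖ₑ :=
    fun x ξ => by rw [← ofReal_norm, norm_momentumKernel_apply, ofReal_norm]
  simp_rw [h1]
  -- After integrating over `x` first, translation invariance removes `ξ`, leaving the square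
  -- integral of `f` times `volume s`.
  rw [lintegral_lintegral_swap]
  · simp_rw [lintegral_add_left_eq_self (μ := (volume : Measure (Plane N)))
      (fun x => ‖f x‖ₑ ^ 2)]
    rw [lintegral_const, Measure.restrict_apply_univ]
    refine ENNReal.mul_ne_top ?_ hs'
    have h2 := (f.memLp 2 volume).eLpNorm_ne_top
    rw [eLpNorm_eq_lintegral_rpow_enorm_toReal (by norm_num) (by norm_num)] at h2
    intro h3
    refine h2 ?_
    norm_num [h3]
  · have := f.continuous
    refine Continuous.aemeasurable ?_
    have h4 := (sympEquiv N θ hθ).symm.continuous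
    simp only [Function.uncurry_def]
    fun_prop

/-- Left Moyal multiplication is compact on spinors of bounded momentum. -/
theorem isCompactOperator_rep_fourierInv_cutoff (θ : ℝ) (hθ : θ ≠ 0) (f : 𝓢(Plane N, ℂ))
    {s : Set (Plane N)} (hs : MeasurableSet s) (hs' : volume s ≠ ∞) :
    IsCompactOperator (rep θ hθ f ∘L
      (Lp.fourierTransformₗᵢ (Plane N) (Fibre N)).symm.toContinuousLinearEquiv.toContinuousLinearMap
        ∘L cutoff hs) := by
  obtain ⟨c, hc⟩ := exists_moyalProd_eq (N := N) θ hθ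
  -- The value at `x` is the pairing of `g` with the kernel `A x`; the cutoff is shifted from `g`
  -- onto this kernel to make it square integrable in both variables.
  let A : Plane N → Lp ℂ 2 (volume : Measure (Plane N)) := fun x =>
    cutoff hs ((momentumKernel θ hθ f x).toLp 2)
  let B := (ContinuousLinearMap.lsmul ℂ ℂ : ℂ →L[ℂ] Fibre N →L[ℂ] Fibre N).lpPairing
    (volume : Measure (Plane N)) 2 2
  refine isCompactOperator_of_ae_eq_apply _ (fun x => c • B (A x)) (fun g => ?_) ?_
  · refine (coeFn_leftMoyal θ hθ f _).trans (.of_forall fun x => ?_)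
    change moyalProd θ f (𝓕⁻ (cutoff hs g) : Spinors N) x = _
    beta_reduce
    rw [hc, FourierTransform.fourier_fourierInv_eq, smul_apply,
      ContinuousLinearMap.lpPairing_eq_integral]
    congr 1
    refine integral_congr_ae ?_
    filter_upwards [coeFn_cutoff hs g, coeFn_cutoff hs ((momentumKernel θ hθ f x).toLp 2),
      (momentumKernel θ hθ f x).coeFn_toLp 2 volume] with ξ h1 h2 h3
    rw [h1, h2]
    by_cases hξ : ξ ∈ s <;> simp [hξ, h3]
  · have hA : ∀ x, ‖A x‖ₑ ^ 2 = ∫⁻ ξ in s, ‖momentumKernel θ hθ f x ξ‖ₑ ^ 2 := fun x => by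
      rw [Lp.enorm_def, eLpNorm_congr_ae (coeFn_cutoff hs _), eLpNorm_indicator_eq_eLpNorm_restrict hs,
        eLpNorm_congr_ae (ae_restrict_of_ae ((momentumKernel θ hθ f x).coeFn_toLp 2 volume)),
        eLpNorm_eq_lintegral_rpow_enorm_toReal (by norm_num) (by norm_num), ← ENNReal.rpow_natCast,
        ← ENNReal.rpow_mul]
      norm_num
    have hB : ∀ x, ‖c • B (A x)‖ₑ ^ 2 ≤
        (‖c‖ₑ * ‖B‖ₑ) ^ 2 * ∫⁻ ξ in s, ‖momentumKernel θ hθ f x ξ‖ₑ ^ 2 := fun x => by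
      rw [← hA, ← mul_pow, enorm_smul, mul_assoc]
      gcongr
      exact B.le_opENorm _
    refine ne_top_of_le_ne_top ?_ (lintegral_mono hB)
    rw [lintegral_const_mul' _ _ (by finiteness)]
    exact ENNReal.mul_ne_top (by finiteness) (lintegral_momentumKernel_ne_top θ hθ f hs')

end Kernel


/-! ### Removing the momentum cutoff -/

/-- `f ⋆ ·` times any bounded operator `R` into the domain of the Dirac operator for which `D R`
is bounded is compact. -/
theorem isCompactOperator_rep_comp {N : ℕ} (θ : ℝ) (hθ : θ ≠ 0)
    {γ : Fin N ⊕ Fin N → Matrix (Fin (2 ^ N)) (Fin (2 ^ N)) ℂ} (hγ : IsDiracMatrices γ)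
    (f : 𝓢(Plane N, ℂ)) (R : Spinors N →L[ℂ] Spinors N) (C : ℝ)
    (hR : ∀ x, ∃ h : R x ∈ (dirac γ).domain, ‖dirac γ ⟨R x, h⟩‖ ≤ C * ‖x‖) :
    IsCompactOperator (rep θ hθ f ∘L R) := by
  let 𝓕L := Lp.fourierTransformₗᵢ (Plane N) (Fibre N)
  let F := 𝓕L.toContinuousLinearEquiv.toContinuousLinearMap
  let Fi := 𝓕L.symm.toContinuousLinearEquiv.toContinuousLinearMap
  have hball : ∀ n : ℕ, MeasurableSet (Metric.closedBall (0 : Plane N) (n + 1)) := fun n =>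
    Metric.isClosed_closedBall.measurableSet
  -- The radius `n + 1` is positive for every `n`, as the cutoff estimate requires.
  let A : ℕ → Spinors N →L[ℂ] Spinors N := fun n =>
    (rep θ hθ f ∘L Fi ∘L cutoff (hball n)) ∘L (F ∘L R)
  refine isCompactOperator_of_tendsto (l := Filter.atTop) (F := A) ?_
    (Filter.Eventually.of_forall fun n =>
      (isCompactOperator_rep_fourierInv_cutoff θ hθ f (hball n)
        measure_closedBall_lt_top.ne).comp_clm (F ∘L R))
  -- `|C|` replaces `C`, whose sign is not assumed, to keep the bound nonnegative.
  have hbound : ∀ n : ℕ, ‖A n - rep θ hθ f ∘L R‖ ≤ ‖rep θ hθ f‖ * (|C| * (1 / (n + 1 : ℝ))) := by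
    intro n
    refine ContinuousLinearMap.opNorm_le_bound _ (by positivity) fun x => ?_
    obtain ⟨h, hx⟩ := hR x
    have h1 : (rep θ hθ f ∘L R - A n) x =
        rep θ hθ f (Fi (F (R x) - cutoff (hball n) (F (R x)))) := by
      rw [map_sub, map_sub]
      change _ - _ = rep θ hθ f (𝓕L.symm (𝓕L (R x))) - _
      rw [LinearIsometryEquiv.symm_apply_apply]
      rfl
    have h2 : ‖Fi (F (R x) - cutoff (hball n) (F (R x)))‖ ≤ (n + 1 : ℝ)⁻¹ * ‖dirac γ ⟨R x, h⟩‖ :=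
      (𝓕L.symm.norm_map _).le.trans (norm_sub_cutoff_fourier_le hγ ⟨R x, h⟩ (by positivity))
    rw [← norm_neg, ← neg_apply, neg_sub, h1]
    calc _ ≤ ‖rep θ hθ f‖ * ‖Fi (F (R x) - cutoff (hball n) (F (R x)))‖ :=
          ContinuousLinearMap.le_opNorm _ _
      _ ≤ ‖rep θ hθ f‖ * ((n + 1 : ℝ)⁻¹ * (|C| * ‖x‖)) := by
          gcongr
          refine h2.trans ?_
          gcongr
          exact hx.trans (by gcongr; exact le_abs_self C)
      _ = _ := by ring
  rw [tendsto_iff_norm_sub_tendsto_zero]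
  refine squeeze_zero (fun _ => norm_nonneg _) hbound ?_
  simpa using (tendsto_one_div_add_atTop_nhds_zero_nat.const_mul |C|).const_mul ‖rep θ hθ f‖

end Moyal

end

theorem mainTheorem4 (N : ℕ) (θ : ℝ) (hθ : θ ≠ 0)
    (γ : Fin N ⊕ Fin N → Matrix (Fin (2 ^ N)) (Fin (2 ^ N)) ℂ) (hγ : Moyal.IsDiracMatrices γ)
    (f : SchwartzMap (Moyal.Plane N) ℂ) (z : ℂ) (hz : z ∉ Moyal.spec (Moyal.dirac γ)) :
    IsCompactOperator (Moyal.rep θ hθ f ∘L Moyal.resolventOp (Moyal.dirac γ) z) := by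
  -- The constant comes from `D R x = x + z R x`.
  refine Moyal.isCompactOperator_rep_comp θ hθ hγ f _
    (1 + ‖z‖ * ‖Moyal.resolventOp (Moyal.dirac γ) z‖) fun x => ?_
  obtain ⟨h, hx⟩ := (Moyal.isResolventAt_resolventOp hz).1 x
  refine ⟨h, ?_⟩
  rw [sub_eq_iff_eq_add.1 hx]
  refine (norm_add_le _ _).trans ?_
  rw [add_mul, one_mul, norm_smul, mul_assoc]
  gcongr
  exact ContinuousLinearMap.le_opNorm _ _
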